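/- Let $d,T\in\mathbb N$ and $0<B\le T$. Consider the $T$-round linear bandit problem with arm set $[-1,1]^d$ and unknown parameter $\theta\in\mathbb R^d$: in each round $t$ the learner picks an arm $x_t\in[-1,1]^d$ and a bit $q_t\in\{0,1\}$, possibly at random and depending on $(x_s,q_s,Y_s)_{s<t}$, and observes $Y_t=q_tR_t$, where $R_t=\langle x_t,\theta\rangle+\eta_t$ and the $\eta_t$ are i.i.d. standard Gaussian noises (thus the reward is observed only when it is queried, $q_t=1$). The regret is $\mathrm{Reg}(T)=\sum_{t=1}^T\bigl(\max_{x\in[-1,1]^d}\langle x,\theta\rangle-\langle x_t,\theta\rangle\bigr)$, and $n^q_T=\sum_{t=1}^T q_t$ is the number of queries. Let $\pi$ be a policy such that $n^q_T\le B$ almost surely on every instance with $\theta\in\{-1/\sqrt B,1/\sqrt B\}^d$. Then there is a parameter $\theta\in\{-1/\sqrt B,1/\sqrt B\}^d$ for which the expected regret of $\pi$ satisfies $$\mathbb E[\mathrm{Reg}(T)]\ \ge\ \frac{dT}{80\sqrt B}.$$ -/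

import Mathlib

open MeasureTheory ProbabilityTheory

noncomputable section

namespace LinearBandit

/-- The arm set `[-1, 1]^d`. -/
abbrev Arm (d : ℕ) : Type := Fin d → Set.Icc (-1 : ℝ) 1

/-- The mean reward `⟨x, θ⟩` of the arm `x` in the instance with parameter `θ`. -/
def meanReward {d : ℕ} (θ : Fin d → ℝ) (x : Arm d) : ℝ := ∑ i, (x i : ℝ) * θ i

/-- What the learner sees in one round: the chosen arm `x`, the query bit `q`
(`true` means that the reward is queried), and the observation `Y = R * q`. -/
abbrev Round (d : ℕ) : Type := (Arm d × Bool) × ℝ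

/-- The record of the first `t` rounds. -/
abbrev History (d t : ℕ) : Type := Fin t → Round d

/-- A (possibly randomized) policy: given everything observed in the first `t` rounds, the law of
the next arm and query bit. The parameter `θ` and the unqueried rewards are not available to it. -/
structure Policy (d : ℕ) where
  rule : (t : ℕ) → Kernel (History d t) (Arm d × Bool)
  markov : ∀ t, IsMarkovKernel (rule t)

instance {d : ℕ} (π : Policy d) (t : ℕ) : IsMarkovKernel (π.rule t) := π.markov t

theorem measurable_meanReward {d : ℕ} (θ : Fin d → ℝ) : Measurable (meanReward θ) := by
  unfold meanReward
  fun_prop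

/-- The law of the observation `Y` given the arm `x` and the query bit `q`: if the reward
`R = ⟨x, θ⟩ + η` with `η` standard Gaussian is queried, then `Y = R`, otherwise `Y = 0`. -/
def feedback {d : ℕ} (θ : Fin d → ℝ) : Kernel (Arm d × Bool) ℝ where
  toFun a := if a.2 = true then gaussianReal (meanReward θ a.1) 1 else Measure.dirac 0
  measurable' := by
    refine Measurable.ite (measurable_snd (measurableSet_singleton true)) ?_ measurable_const
    exact measurable_gaussianReal.comp
      (((measurable_meanReward θ).comp measurable_fst).prodMk measurable_const)

instance {d : ℕ} (θ : Fin d → ℝ) : IsMarkovKernel (feedback θ) where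
  isProbabilityMeasure a := by
    change IsProbabilityMeasure
      (if a.2 = true then gaussianReal (meanReward θ a.1) 1 else Measure.dirac 0)
    split_ifs <;> infer_instance

/-- One round of the interaction: the policy picks an arm and a query bit, and the observation is
then drawn from its law given these alone, independently of the past. -/
def step {d : ℕ} (π : Policy d) (θ : Fin d → ℝ) (t : ℕ) : Kernel (History d t) (Round d) :=
  (π.rule t).compProd (Kernel.prodMkLeft (History d t) (feedback θ))

instance {d : ℕ} (π : Policy d) (θ : Fin d → ℝ) (t : ℕ) : IsMarkovKernel (step π θ t) := by
  unfold step
  infer_instance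

/-- Append a round to a history. -/
def append {d t : ℕ} (p : History d t × Round d) : History d (t + 1) :=
  Fin.snoc (α := fun _ => Round d) p.1 p.2

theorem measurable_append {d t : ℕ} : Measurable (append (d := d) (t := t)) := by
  refine measurable_pi_iff.mpr fun i => ?_
  refine Fin.lastCases ?_ (fun j => ?_) i
  · simpa [append] using measurable_snd
  · simp only [append, Fin.snoc_castSucc]
    exact (measurable_pi_apply j).comp measurable_fst

/-- The law of the first `t` rounds when the policy `π` interacts with the instance `θ`. -/
def historyLaw {d : ℕ} (π : Policy d) (θ : Fin d → ℝ) : (t : ℕ) → Measure (History d t)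
  | 0 => Measure.dirac Fin.elim0
  | t + 1 => ((historyLaw π θ t).compProd (step π θ t)).map append

theorem isProbabilityMeasure_historyLaw {d : ℕ} (π : Policy d) (θ : Fin d → ℝ) (t : ℕ) :
    IsProbabilityMeasure (historyLaw π θ t) := by
  induction t with
  | zero => unfold historyLaw; infer_instance
  | succ t ih =>
    unfold historyLaw
    exact Measure.isProbabilityMeasure_map measurable_append.aemeasurable

instance {d : ℕ} (π : Policy d) (θ : Fin d → ℝ) (t : ℕ) :
    IsProbabilityMeasure (historyLaw π θ t) := isProbabilityMeasure_historyLaw π θ t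

/-- The number of queries made during a history. -/
def numQueries {d t : ℕ} (h : History d t) : ℕ := ∑ k, if (h k).1.2 = true then 1 else 0

/-- The largest mean reward of an arm. -/
def bestReward {d : ℕ} (θ : Fin d → ℝ) : ℝ := ⨆ x : Arm d, meanReward θ x

/-- The supremum defining `bestReward` is a maximum, with value `∑ |θ i|`. -/
theorem isGreatest_bestReward {d : ℕ} (θ : Fin d → ℝ) :
    IsGreatest (Set.range (meanReward θ)) (bestReward θ) ∧ bestReward θ = ∑ i, |θ i| := by
  have h : IsGreatest (Set.range (meanReward θ)) (∑ i, |θ i|) := by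
    constructor
    · refine ⟨fun i => if 0 ≤ θ i then ⟨1, by norm_num, by norm_num⟩
        else ⟨-1, by norm_num, by norm_num⟩, ?_⟩
      unfold meanReward
      refine Finset.sum_congr rfl fun i _ => ?_
      by_cases h : 0 ≤ θ i
      · simp [h, abs_of_nonneg h]
      · simp [h, abs_of_neg (not_le.mp h)]
    · rintro _ ⟨x, rfl⟩
      unfold meanReward
      refine Finset.sum_le_sum fun i _ => (le_abs_self _).trans ?_
      rw [abs_mul]
      exact mul_le_of_le_one_left (abs_nonneg _) (abs_le.mpr (x i).2)
  have e : bestReward θ = ∑ i, |θ i| := h.csSup_eq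
  exact ⟨e ▸ h, e⟩

/-- The pseudo-regret accumulated along a history. -/
def regret {d t : ℕ} (θ : Fin d → ℝ) (h : History d t) : ℝ :=
  ∑ k, (bestReward θ - meanReward θ (h k).1.1)

/-- The expected regret of the policy `π` on the instance `θ` over `T` rounds. -/
def expectedRegret {d : ℕ} (π : Policy d) (θ : Fin d → ℝ) (T : ℕ) : ℝ :=
  ∫ h, regret θ h ∂(historyLaw π θ T)

end LinearBandit

end

open LinearBandit

/-! Assouad's method on the cube of sign vectors. Two instances differing in the sign of coordinate
`i` have mean rewards at most `2 / √B` apart, and only queried rounds carry information, so with `B`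
queries the Hellinger affinity of the two history laws stays at least `exp (-1/2)`
(`one_le_lintegral_historyLaw`). Hence no test separates them (`le_integral_add_integral`). The
regret due to coordinate `i`, rescaled to `[0, 1]`, is such a test: on every history its values for
the two instances add up to `2T / √B` (`coordRegret_add_of_neg`). So the two expected values sum to
a constant times `T / √B`. Averaging over all sign vectors and summing over coordinates yields a bad
instance. -/

/-! ### Likelihood ratios along a history -/

/-- The log-likelihood ratio of the instance `θ'` to the instance `θ` in one round. -/
noncomputable def roundLLR {d : ℕ} (θ θ' : Fin d → ℝ) (r : Round d) : ℝ :=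
  if r.1.2 = true then
    (meanReward θ' r.1.1 - meanReward θ r.1.1) * r.2
      - (meanReward θ' r.1.1 ^ 2 - meanReward θ r.1.1 ^ 2) / 2
  else 0

/-- The log-likelihood ratio of the instance `θ'` to the instance `θ` along a history. -/
noncomputable def historyLLR {d t : ℕ} (θ θ' : Fin d → ℝ) (h : History d t) : ℝ := ∑ k, roundLLR θ θ' (h k)

theorem measurable_roundLLR {d : ℕ} (θ θ' : Fin d → ℝ) : Measurable (roundLLR θ θ') := by
  have h := measurable_meanReward θ
  have h' := measurable_meanReward θ'
  refine Measurable.ite ((measurable_snd.comp measurable_fst) (measurableSet_singleton true)) ?_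
    measurable_const
  fun_prop

theorem measurable_historyLLR {d t : ℕ} (θ θ' : Fin d → ℝ) :
    Measurable (historyLLR (t := t) θ θ') := by
  have := measurable_roundLLR θ θ'
  unfold historyLLR
  fun_prop

theorem measurable_numQueries {d t : ℕ} : Measurable (numQueries (d := d) (t := t)) := by
  unfold numQueries
  refine Finset.measurable_sum _ fun k _ => ?_
  exact Measurable.ite (((measurable_snd.comp measurable_fst).comp (measurable_pi_apply k))
    (measurableSet_singleton true)) measurable_const measurable_const

theorem historyLLR_append {d t : ℕ} (θ θ' : Fin d → ℝ) (h : History d t) (r : Round d) :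
    historyLLR θ θ' (append (h, r)) = historyLLR θ θ' h + roundLLR θ θ' r := by
  simp [historyLLR, append, Fin.sum_univ_castSucc]

theorem numQueries_append {d t : ℕ} (h : History d t) (r : Round d) :
    numQueries (append (h, r)) = numQueries h + if r.1.2 = true then 1 else 0 := by
  simp [numQueries, append, Fin.sum_univ_castSucc]

theorem lintegral_historyLaw_succ {d t : ℕ} (π : Policy d) (θ : Fin d → ℝ)
    {f : History d (t + 1) → ENNReal} (hf : Measurable f) :
    ∫⁻ h, f h ∂historyLaw π θ (t + 1) =
      ∫⁻ h, ∫⁻ a, ∫⁻ y, f (append (h, (a, y))) ∂feedback θ a ∂π.rule t h ∂historyLaw π θ t := by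
  have hfa : Measurable fun p : History d t × Round d => f (append p) :=
    hf.comp measurable_append
  change ∫⁻ h, f h ∂((historyLaw π θ t).compProd (step π θ t)).map append = _
  rw [lintegral_map hf measurable_append, Measure.lintegral_compProd hfa]
  refine lintegral_congr fun h => ?_
  unfold step
  exact Kernel.lintegral_compProd _ _ _ (hfa.comp measurable_prodMk_left)

/-! ### One round: Gaussian tilting and affinity -/

theorem gaussianPDF_eq_mul (m m' y : ℝ) :
    gaussianPDF m' 1 y =
      ENNReal.ofReal (Real.exp ((m' - m) * y - (m' ^ 2 - m ^ 2) / 2)) * gaussianPDF m 1 y := by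
  rw [gaussianPDF, gaussianPDF, ← ENNReal.ofReal_mul (Real.exp_pos _).le, gaussianPDFReal,
    gaussianPDFReal, mul_left_comm, ← Real.exp_add]
  congr 3
  push_cast
  ring

theorem lintegral_gaussianReal_eq_exp_mul (m m' : ℝ) {f : ℝ → ENNReal} (hf : Measurable f) :
    ∫⁻ y, f y ∂gaussianReal m' 1 =
      ∫⁻ y, ENNReal.ofReal (Real.exp ((m' - m) * y - (m' ^ 2 - m ^ 2) / 2)) * f y
        ∂gaussianReal m 1 := by
  rw [gaussianReal_of_var_ne_zero _ one_ne_zero, gaussianReal_of_var_ne_zero _ one_ne_zero,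
    lintegral_withDensity_eq_lintegral_mul _ (measurable_gaussianPDF _ _) hf,
    lintegral_withDensity_eq_lintegral_mul _ (measurable_gaussianPDF _ _) (by fun_prop)]
  refine lintegral_congr fun y => ?_
  simp only [Pi.mul_apply]
  rw [gaussianPDF_eq_mul m m']
  ring

/-- The Hellinger affinity of two Gaussians with unit variance. -/
theorem lintegral_gaussianReal_exp_half (m m' : ℝ) :
    ∫⁻ y, ENNReal.ofReal (Real.exp (((m' - m) * y - (m' ^ 2 - m ^ 2) / 2) / 2))
        ∂gaussianReal m 1 = ENNReal.ofReal (Real.exp (-(m' - m) ^ 2 / 8)) := by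
  -- Half the log-likelihood ratio is that of the midpoint mean minus the constant `(m' - m) ^ 2 /
  -- 8`.
  have h := lintegral_gaussianReal_eq_exp_mul m ((m + m') / 2)
    (f := fun _ => ENNReal.ofReal (Real.exp (-(m' - m) ^ 2 / 8))) measurable_const
  rw [lintegral_const, measure_univ, mul_one] at h
  rw [h]
  refine lintegral_congr fun y => ?_
  rw [← ENNReal.ofReal_mul (Real.exp_pos _).le, ← Real.exp_add]
  congr 2
  ring

/-- Without a query both laws are the Dirac mass at `0`, so the ratio is `1`. -/
theorem lintegral_feedback_eq_exp_mul {d : ℕ} (θ θ' : Fin d → ℝ) (a : Arm d × Bool)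
    {f : ℝ → ENNReal} (hf : Measurable f) :
    ∫⁻ y, f y ∂feedback θ' a =
      ∫⁻ y, ENNReal.ofReal (Real.exp (roundLLR θ θ' (a, y))) * f y ∂feedback θ a := by
  change ∫⁻ y, f y ∂(if a.2 = true then gaussianReal (meanReward θ' a.1) 1 else Measure.dirac 0) =
    ∫⁻ y, ENNReal.ofReal (Real.exp (roundLLR θ θ' (a, y))) * f y
      ∂(if a.2 = true then gaussianReal (meanReward θ a.1) 1 else Measure.dirac 0)
  by_cases h : a.2 = true
  · simp only [h, if_true, roundLLR]
    exact lintegral_gaussianReal_eq_exp_mul _ _ hf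
  · simp [h, roundLLR]

/-- In one round, the square root of the likelihood ratio loses at most the factor `exp (-c)` in
expectation if the reward is queried, and nothing otherwise. -/
theorem one_le_lintegral_feedback {d : ℕ} (θ θ' : Fin d → ℝ) (a : Arm d × Bool) {c : ℝ}
    (hc : (meanReward θ' a.1 - meanReward θ a.1) ^ 2 ≤ 8 * c) :
    1 ≤ ∫⁻ y, ENNReal.ofReal (Real.exp (roundLLR θ θ' (a, y) / 2 +
      c * (if a.2 = true then 1 else 0 : ℕ))) ∂feedback θ a := by
  change 1 ≤ ∫⁻ y, _
      ∂(if a.2 = true then gaussianReal (meanReward θ a.1) 1 else Measure.dirac 0)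
  by_cases h : a.2 = true
  · simp only [h, if_true, roundLLR, Nat.cast_one, mul_one, Real.exp_add]
    simp_rw [ENNReal.ofReal_mul (Real.exp_pos _).le]
    rw [lintegral_mul_const _ (by fun_prop), lintegral_gaussianReal_exp_half,
      ← ENNReal.ofReal_mul (Real.exp_pos _).le, ← Real.exp_add, ENNReal.one_le_ofReal,
      Real.one_le_exp_iff]
    linarith
  · simp [h, roundLLR]

/-! ### Whole histories -/

/-- Change of measure between two instances. -/
theorem lintegral_historyLaw_eq_exp_mul {d : ℕ} (π : Policy d) (θ θ' : Fin d → ℝ) (t : ℕ)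
    {f : History d t → ENNReal} (hf : Measurable f) :
    ∫⁻ h, f h ∂historyLaw π θ' t =
      ∫⁻ h, ENNReal.ofReal (Real.exp (historyLLR θ θ' h)) * f h ∂historyLaw π θ t := by
  induction t with
  | zero =>
    change ∫⁻ h, f h ∂Measure.dirac Fin.elim0 = ∫⁻ h, _ ∂Measure.dirac Fin.elim0
    refine lintegral_congr fun h => ?_
    simp [historyLLR]
  | succ t ih =>
    have hL := measurable_historyLLR (t := t) θ θ'
    have hL' := measurable_historyLLR (t := t + 1) θ θ'
    have hr := measurable_roundLLR θ θ'
    have hfa : Measurable fun p : History d t × Round d => f (append p) :=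
      hf.comp measurable_append
    rw [lintegral_historyLaw_succ π θ' hf, lintegral_historyLaw_succ π θ (by fun_prop)]
    have hin : Measurable fun h : History d t =>
        ∫⁻ a, ∫⁻ y, f (append (h, (a, y))) ∂feedback θ' a ∂π.rule t h := by
      have h1 : Measurable fun p : History d t × (Arm d × Bool) =>
          ∫⁻ y, f (append (p.1, (p.2, y))) ∂feedback θ' p.2 := by
        refine Measurable.lintegral_kernel_prod_right'
          (κ := Kernel.prodMkLeft (History d t) (feedback θ'))
          (f := fun q : (History d t × (Arm d × Bool)) × ℝ => f (append (q.1.1, (q.1.2, q.2)))) ?_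
        exact hfa.comp (f := fun q : (History d t × (Arm d × Bool)) × ℝ =>
          (q.1.1, (q.1.2, q.2))) (by fun_prop)
      exact h1.lintegral_kernel_prod_right'
    rw [ih hin]
    refine lintegral_congr fun h => ?_
    rw [← lintegral_const_mul' _ _ ENNReal.ofReal_ne_top]
    refine lintegral_congr fun a => ?_
    have hy : Measurable fun y : ℝ => f (append (h, (a, y))) :=
      hfa.comp (f := fun y : ℝ => (h, (a, y))) (by fun_prop)
    rw [lintegral_feedback_eq_exp_mul θ θ' a hy,
      ← lintegral_const_mul' _ _ ENNReal.ofReal_ne_top]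
    refine lintegral_congr fun y => ?_
    rw [historyLLR_append, Real.exp_add, ENNReal.ofReal_mul (Real.exp_pos _).le, mul_assoc]

/-- The square root of the likelihood ratio, compensated by `exp c` for each query, is a
submartingale. -/
theorem one_le_lintegral_historyLaw {d : ℕ} (π : Policy d) (θ θ' : Fin d → ℝ) {c : ℝ}
    (hc : ∀ x : Arm d, (meanReward θ' x - meanReward θ x) ^ 2 ≤ 8 * c) (t : ℕ) :
    1 ≤ ∫⁻ h, ENNReal.ofReal (Real.exp (historyLLR θ θ' h / 2 + c * numQueries h))
      ∂historyLaw π θ t := by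
  induction t with
  | zero =>
    change 1 ≤ ∫⁻ h, _ ∂Measure.dirac Fin.elim0
    simp [historyLLR, numQueries]
  | succ t ih =>
    have hL := measurable_historyLLR (t := t + 1) θ θ'
    have hN := measurable_numQueries (d := d) (t := t + 1)
    have hm : Measurable fun h : History d (t + 1) =>
        ENNReal.ofReal (Real.exp (historyLLR θ θ' h / 2 + c * numQueries h)) := by
      have := (measurable_from_top (f := ((↑) : ℕ → ℝ))).comp hN
      simp only [Function.comp_def] at this
      fun_prop
    rw [lintegral_historyLaw_succ π θ hm]
    refine ih.trans (lintegral_mono fun h => ?_)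
    have hsplit : ∀ a : Arm d × Bool, ∀ y : ℝ,
        ENNReal.ofReal (Real.exp (historyLLR θ θ' (append (h, (a, y))) / 2 +
          c * numQueries (append (h, (a, y))))) =
        ENNReal.ofReal (Real.exp (historyLLR θ θ' h / 2 + c * numQueries h)) *
          ENNReal.ofReal (Real.exp (roundLLR θ θ' (a, y) / 2 +
            c * (if a.2 = true then 1 else 0 : ℕ))) := by
      intro a y
      rw [historyLLR_append, numQueries_append, ← ENNReal.ofReal_mul (Real.exp_pos _).le,
        ← Real.exp_add]
      congr 2
      push_cast
      ring
    simp_rw [hsplit, lintegral_const_mul' _ _ ENNReal.ofReal_ne_top]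
    refine le_mul_of_one_le_right' ?_
    calc (1 : ENNReal) = ∫⁻ _, 1 ∂π.rule t h := by simp
      _ ≤ _ := lintegral_mono fun a => one_le_lintegral_feedback θ θ' a (hc a.1)

/-! ### Testing two instances -/

/-- AM-GM in the form `2 √(ab) ≤ 4 min a b + max a b / 4` with `a = 1`, `b = exp l`: the average of
`1` and `exp l` with weights `g`, `1 - g` is at least their minimum, and their sum at least their
maximum. -/
theorem two_mul_exp_half_le {g l : ℝ} (h0 : 0 ≤ g) (h1 : g ≤ 1) :
    2 * Real.exp (l / 2) ≤
      4 * g + Real.exp l * (4 * (1 - g)) + (1 / 4 + Real.exp l * (1 / 4)) := by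
  have hl : Real.exp l = Real.exp (l / 2) ^ 2 := by
    rw [sq, ← Real.exp_add]
    congr 1
    ring
  rw [hl]
  have hs := Real.exp_pos (l / 2)
  generalize Real.exp (l / 2) = s at hs
  rcases le_total 1 s with h | h
  · nlinarith [sq_nonneg (s - 4), mul_nonneg (sub_nonneg.mpr h1) (by nlinarith : 0 ≤ s ^ 2 - 1)]
  · nlinarith [sq_nonneg (4 * s - 1), mul_nonneg h0 (by nlinarith : 0 ≤ 1 - s ^ 2)]

theorem exp_half_le : Real.exp (1 / 2) ≤ 5 / 3 := by
  have h : Real.exp (1 / 2) ^ 2 = Real.exp 1 := by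
    rw [sq, ← Real.exp_add]
    norm_num
  nlinarith [Real.exp_one_lt_d9, Real.exp_pos (1 / 2)]

/-- A test cannot distinguish two instances whose mean rewards are within `2 / √B` of each other
if at most `B` rewards are queried. -/
theorem le_integral_add_integral {d : ℕ} (π : Policy d) (θ θ' : Fin d → ℝ) (T : ℕ) {B : ℝ}
    (hB : 0 < B) (hθ : ∀ x : Arm d, (meanReward θ' x - meanReward θ x) ^ 2 ≤ 4 / B)
    (hq : ∀ᵐ h ∂historyLaw π θ T, (numQueries h : ℝ) ≤ B)
    {g : History d T → ℝ} (hg : Measurable g) (h0 : ∀ h, 0 ≤ g h) (h1 : ∀ h, g h ≤ 1) :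
    1 / 6 ≤ ∫ h, g h ∂historyLaw π θ T + ∫ h, (1 - g h) ∂historyLaw π θ' T := by
  have hL := measurable_historyLLR (t := T) θ θ'
  -- This `c` solves `8 * c = 4 / B`; over at most `B` queries the compensation is at most `exp
  -- (1/2) ≤ 5/3`.
  have hsub := one_le_lintegral_historyLaw π θ θ' (c := 1 / (2 * B))
    (fun x => (hθ x).trans_eq (by field_simp; norm_num)) T
  have hg4 : Measurable fun h => ENNReal.ofReal (4 * (1 - g h)) := by fun_prop
  have hint : ∀ (ϑ : Fin d → ℝ) {f : History d T → ℝ}, Measurable f → (∀ h, 0 ≤ f h) →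
      (∀ h, f h ≤ 4) → ∫⁻ h, ENNReal.ofReal (f h) ∂historyLaw π ϑ T =
        ENNReal.ofReal (∫ h, f h ∂historyLaw π ϑ T) := by
    intro ϑ f hf hf0 hf4
    refine (ofReal_integral_eq_lintegral_ofReal ?_ (ae_of_all _ hf0)).symm
    refine Integrable.of_bound hf.aestronglyMeasurable 4 (ae_of_all _ fun h => ?_)
    rw [Real.norm_of_nonneg (hf0 h)]
    exact hf4 h
  have key : ∫⁻ h, ENNReal.ofReal (Real.exp (historyLLR θ θ' h / 2 + 1 / (2 * B) * numQueries h))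
      ∂historyLaw π θ T ≤ ENNReal.ofReal (5 / 6) *
        (∫⁻ h, ENNReal.ofReal (4 * g h) ∂historyLaw π θ T +
          ∫⁻ h, ENNReal.ofReal (4 * (1 - g h)) ∂historyLaw π θ' T +
          (∫⁻ _, ENNReal.ofReal (1 / 4) ∂historyLaw π θ T +
            ∫⁻ _, ENNReal.ofReal (1 / 4) ∂historyLaw π θ' T)) := by
    -- With all integrals taken under `θ`, the bound becomes pointwise, and the query budget is
    -- needed under `θ` only.
    rw [lintegral_historyLaw_eq_exp_mul π θ θ' T hg4,
      lintegral_historyLaw_eq_exp_mul π θ θ' T measurable_const,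
      ← lintegral_add_left (by fun_prop), ← lintegral_add_left (by fun_prop),
      ← lintegral_add_left (by fun_prop), ← lintegral_const_mul _ (by fun_prop)]
    refine lintegral_mono_ae ?_
    filter_upwards [hq] with h hh
    have e := (Real.exp_pos (historyLLR θ θ' h)).le
    have n1 := h0 h
    have n2 := sub_nonneg.mpr (h1 h)
    rw [← ENNReal.ofReal_mul e, ← ENNReal.ofReal_mul e,
      ← ENNReal.ofReal_add (by positivity) (by positivity),
      ← ENNReal.ofReal_add (by positivity) (by positivity),
      ← ENNReal.ofReal_add (by positivity) (by positivity), ← ENNReal.ofReal_mul (by norm_num)]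
    refine ENNReal.ofReal_le_ofReal ?_
    rw [Real.exp_add]
    have hN : Real.exp (1 / (2 * B) * numQueries h) ≤ 5 / 3 := by
      refine le_trans (Real.exp_le_exp.mpr ?_) exp_half_le
      rw [one_div_mul_eq_div, div_le_div_iff₀ (by positivity) (by norm_num)]
      linarith
    have := two_mul_exp_half_le (l := historyLLR θ θ' h) (h0 h) (h1 h)
    nlinarith [mul_le_mul_of_nonneg_left hN (Real.exp_pos (historyLLR θ θ' h / 2)).le]
  rw [hint θ (f := fun h => 4 * g h) (by fun_prop) (fun h => by linarith [h0 h]) (fun h => by linarith [h1 h]),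
    hint θ' (f := fun h => 4 * (1 - g h)) (by fun_prop) (fun h => by linarith [h1 h]) (fun h => by linarith [h0 h]),
    lintegral_const, lintegral_const, measure_univ, measure_univ, mul_one,
    integral_const_mul, integral_const_mul] at key
  have i1 : 0 ≤ ∫ h, g h ∂historyLaw π θ T := integral_nonneg h0
  have i2 : 0 ≤ ∫ h, (1 - g h) ∂historyLaw π θ' T :=
    integral_nonneg fun h => sub_nonneg.mpr (h1 h)
  rw [← ENNReal.ofReal_add (by positivity) (by positivity),
    ← ENNReal.ofReal_add (by positivity) (by positivity),
    ← ENNReal.ofReal_add (by positivity) (by positivity),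
    ← ENNReal.ofReal_mul (by norm_num)] at key
  -- With `S` the sum of the two errors, `1 ≤ 5/6 * (4 * S + 1/2)`, so `S ≥ 7/40 > 1/6`.
  have := ENNReal.one_le_ofReal.mp (hsub.trans key)
  linarith

/-! ### Regret by coordinates -/

/-- The part of the regret that is due to the coordinate `i`. -/
def coordRegret {d t : ℕ} (θ : Fin d → ℝ) (i : Fin d) (h : History d t) : ℝ :=
  ∑ k, (|θ i| - ((h k).1.1 i : ℝ) * θ i)

theorem measurable_coordRegret {d t : ℕ} (θ : Fin d → ℝ) (i : Fin d) :
    Measurable (coordRegret (t := t) θ i) := by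
  unfold coordRegret
  fun_prop

theorem coordRegret_nonneg {d t : ℕ} (θ : Fin d → ℝ) (i : Fin d) (h : History d t) :
    0 ≤ coordRegret θ i h := by
  refine Finset.sum_nonneg fun k _ => sub_nonneg.mpr ((le_abs_self _).trans ?_)
  rw [abs_mul]
  exact mul_le_of_le_one_left (abs_nonneg _) (abs_le.mpr ((h k).1.1 i).2)

theorem coordRegret_add_of_neg {d t : ℕ} {θ θ' : Fin d → ℝ} {i : Fin d} (hi : θ' i = -θ i)
    (h : History d t) : coordRegret θ i h + coordRegret θ' i h = 2 * t * |θ i| := by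
  rw [coordRegret, coordRegret, ← Finset.sum_add_distrib, hi, abs_neg,
    Finset.sum_congr rfl fun k _ => show _ = 2 * |θ i| by ring]
  simp
  ring

theorem integrable_coordRegret {d t : ℕ} (π : Policy d) (θ : Fin d → ℝ) (i : Fin d) :
    Integrable (coordRegret (t := t) θ i) (historyLaw π θ t) := by
  refine Integrable.of_bound (measurable_coordRegret θ i).aestronglyMeasurable (2 * t * |θ i|)
    (ae_of_all _ fun h => ?_)
  rw [Real.norm_of_nonneg (coordRegret_nonneg θ i h)]
  -- The bound comes from the nonnegative regret of the mirrored instance `-θ`.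
  have := coordRegret_add_of_neg (θ := θ) (θ' := -θ) (i := i) rfl h
  linarith [coordRegret_nonneg (-θ) i h]

theorem expectedRegret_eq_sum {d : ℕ} (π : Policy d) (θ : Fin d → ℝ) (T : ℕ) :
    expectedRegret π θ T = ∑ i, ∫ h, coordRegret θ i h ∂historyLaw π θ T := by
  rw [expectedRegret, ← integral_finsetSum _ fun i _ => integrable_coordRegret π θ i]
  refine integral_congr_ae (ae_of_all _ fun h => ?_)
  simp only [regret, coordRegret, (isGreatest_bestReward θ).2, meanReward]
  rw [Finset.sum_comm]
  simp

/-- On one of two instances that differ by the sign of one coordinate, that coordinate causes a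
large regret. -/
theorem le_coordRegret_add_coordRegret {d : ℕ} (π : Policy d) (θ θ' : Fin d → ℝ) (i : Fin d)
    (hi : θ' i = -θ i) (hne : ∀ j, j ≠ i → θ' j = θ j) {T : ℕ} (hT : 0 < T) {B : ℝ} (hB : 0 < B)
    (hθ : |θ i| = 1 / √B) (hq : ∀ᵐ h ∂historyLaw π θ T, (numQueries h : ℝ) ≤ B) :
    T / (3 * √B) ≤ ∫ h, coordRegret θ i h ∂historyLaw π θ T +
      ∫ h, coordRegret θ' i h ∂historyLaw π θ' T := by
  have hT' : (0 : ℝ) < T := by exact_mod_cast hT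
  have hs : 0 < √B := Real.sqrt_pos.mpr hB
  set C : ℝ := 2 * T / √B with hC
  have hCpos : 0 < C := by positivity
  have hsum : ∀ h : History d T, coordRegret θ i h + coordRegret θ' i h = C := by
    intro h
    rw [coordRegret_add_of_neg hi, hθ, hC]
    ring
  have hmean : ∀ x : Arm d, (meanReward θ' x - meanReward θ x) ^ 2 ≤ 4 / B := by
    intro x
    have e : meanReward θ' x - meanReward θ x = -2 * ((x i : ℝ) * θ i) := by
      rw [meanReward, meanReward, ← Finset.sum_sub_distrib,
        Finset.sum_eq_single i (fun j _ hj => by rw [hne j hj, sub_self])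
          (fun h => absurd (Finset.mem_univ i) h), hi]
      ring
    have hx : (x i : ℝ) ^ 2 ≤ 1 := by
      rw [← sq_abs]
      exact pow_le_one₀ (abs_nonneg _) (abs_le.mpr (x i).2)
    have hsq : θ i ^ 2 = 1 / B := by
      rw [← sq_abs, hθ, div_pow, one_pow, Real.sq_sqrt hB.le]
    have hB' : 0 < 1 / B := by positivity
    rw [e, mul_pow, mul_pow, hsq, show 4 / B = (-2) ^ 2 * (1 * (1 / B)) by ring]
    gcongr
  -- As `C` is the sum of both regrets on any history, the complement of this test is the rescaled
  -- regret for `θ'`.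
  have key := le_integral_add_integral π θ θ' T hB hmean hq
    (g := fun h => coordRegret θ i h / C) ((measurable_coordRegret θ i).div_const C)
    (fun h => div_nonneg (coordRegret_nonneg θ i h) hCpos.le)
    (fun h => (div_le_one hCpos).mpr (by linarith [hsum h, coordRegret_nonneg θ' i h]))
  have e : ∀ h : History d T, 1 - coordRegret θ i h / C = coordRegret θ' i h / C := by
    intro h
    rw [← hsum h]
    have : coordRegret θ i h + coordRegret θ' i h ≠ 0 := by rw [hsum h]; exact hCpos.ne'
    field_simp
    ring
  simp_rw [e] at key
  rw [integral_div, integral_div, ← add_div, le_div_iff₀ hCpos] at key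
  refine le_trans (le_of_eq ?_) key
  rw [hC]
  field_simp
  norm_num

/-! ### Averaging over sign vectors -/

/-- The vector with entries `±ε` and the given signs. -/
def signVector {d : ℕ} (ε : ℝ) (s : Fin d → Bool) (i : Fin d) : ℝ := if s i then ε else -ε

theorem abs_signVector {d : ℕ} {ε : ℝ} (hε : 0 ≤ ε) (s : Fin d → Bool) (i : Fin d) :
    |signVector ε s i| = ε := by
  unfold signVector
  split_ifs <;> simp [abs_of_nonneg hε]

/-- Flipping one sign. -/
def flipSign {d : ℕ} (i : Fin d) : Equiv.Perm (Fin d → Bool) :=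
  Function.Involutive.toPerm (fun s => Function.update s i (!s i)) fun s => by
    simp

theorem flipSign_apply {d : ℕ} (i : Fin d) (s : Fin d → Bool) :
    flipSign i s = Function.update s i (!s i) := rfl

theorem signVector_flipSign_self {d : ℕ} (ε : ℝ) (s : Fin d → Bool) (i : Fin d) :
    signVector ε (flipSign i s) i = -signVector ε s i := by
  cases h : s i <;> simp [signVector, flipSign_apply, h]

theorem signVector_flipSign_of_ne {d : ℕ} (ε : ℝ) (s : Fin d → Bool) {i j : Fin d} (hj : j ≠ i) :
    signVector ε (flipSign i s) j = signVector ε s j := by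
  simp [signVector, flipSign_apply, hj]

theorem mainTheorem7 (d T : ℕ) (B : ℝ) (hB : 0 < B) (hBT : B ≤ T)
    (π : LinearBandit.Policy d)
    (hπ : ∀ θ : Fin d → ℝ, (∀ i, |θ i| = 1 / √B) →
      ∀ᵐ h ∂(LinearBandit.historyLaw π θ T), (LinearBandit.numQueries h : ℝ) ≤ B) :
    ∃ θ : Fin d → ℝ, (∀ i, |θ i| = 1 / √B) ∧
      (d : ℝ) * T / (80 * √B) ≤ LinearBandit.expectedRegret π θ T := by
  have hs : 0 < √B := Real.sqrt_pos.mpr hB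
  have hT : 0 < T := by exact_mod_cast hB.trans_le hBT
  have habs := fun s : Fin d → Bool => abs_signVector (ε := 1 / √B) (by positivity) s
  let r (i : Fin d) (s : Fin d → Bool) : ℝ :=
    ∫ h, coordRegret (signVector (1 / √B) s) i h ∂historyLaw π (signVector (1 / √B) s) T
  have hpair (i : Fin d) (s : Fin d → Bool) : T / (3 * √B) ≤ r i s + r i (flipSign i s) :=
    le_coordRegret_add_coordRegret π _ _ i (signVector_flipSign_self _ s i)
      (fun j hj => signVector_flipSign_of_ne _ s hj) hT hB (habs s i) (hπ _ (habs s))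
  have hcoord (i : Fin d) : ∑ _s : Fin d → Bool, T / (6 * √B) ≤ ∑ s, r i s := by
    have h := Finset.sum_le_sum fun s (_ : s ∈ Finset.univ) => hpair i s
    -- Flipping permutes the sign vectors, so both halves of the pair sum are equal.
    rw [Finset.sum_add_distrib, Equiv.sum_comp (flipSign i) (r i)] at h
    have e : ∑ _s : Fin d → Bool, T / (3 * √B) = 2 * ∑ _s : Fin d → Bool, T / (6 * √B) := by
      rw [Finset.mul_sum]
      refine Finset.sum_congr rfl fun _ _ => ?_
      field_simp
      norm_num
    linarith
  have htotal : ∑ _s : Fin d → Bool, (d : ℝ) * T / (80 * √B) ≤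
      ∑ s, expectedRegret π (signVector (1 / √B) s) T := by
    simp_rw [expectedRegret_eq_sum]
    rw [Finset.sum_comm]
    refine le_trans ?_ (Finset.sum_le_sum fun i _ => hcoord i)
    rw [Finset.sum_comm]
    refine Finset.sum_le_sum fun s _ => ?_
    rw [Finset.sum_const, Finset.card_univ, Fintype.card_fin, nsmul_eq_mul, mul_div_assoc]
    -- The argument gives the constant `1/6`; `1/80` is weaker.
    gcongr
    norm_num
  obtain ⟨s, -, h⟩ := Finset.exists_le_of_sum_le Finset.univ_nonempty htotal
  exact ⟨_, habs s, h⟩
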